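/- Let $T>0$ and let $G\colon\mathbb{R}\times\mathbb{R}\to\mathcal{P}(\mathbb{R})$ satisfy the following structural assumptions. (S1) $G(t,u)=-\mathcal{A}(t,u)+p(t,u)$, where - $\mathcal{A}\colon\mathbb{R}\times\mathbb{R}\to\mathcal{P}(\mathbb{R})\setminus\{\emptyset\}$ is a set-valued map, $T$-periodic in $t$, maximal monotone increasing in $u$ for every $t$, measurable in $t$ for every $u$, and locally bounded by an integrable function: for every $r$ there is $m_r\in L^1_{\mathrm{loc}}(\mathbb{R})$ such that, for almost every $t$, $|y|\le m_r(t)$ for all $|u|\le r$ and all $y\in\mathcal{A}(t,u)$; - $p\colon\mathbb{R}\times\mathbb{R}\to\mathbb{R}$ is a single-valued Carathéodory function (measurable in $t$, continuous in $u$), $T$-periodic in $t$ and locally Lipschitz continuous in $u$ uniformly in $t$. (S2) There are $R>0$ and $T$-periodic measurable functions $\ell_d^\pm\colon\mathbb{R}\to\mathbb{R}$, integrable on $(0,T)$, with $\int_0^T\ell_d^\pm(s)\,\mathrm{d}s<0$, such that for almost every $t\in\mathbb{R}$: $y\ge-\ell_d^-(t)$ for all $u\le -R$ and $y\in G(t,u)$,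 and $y\le\ell_d^+(t)$ for all $u\ge R$ and $y\in G(t,u)$. A solution of $\dot v\in G(t,v)$ on $[0,T]$ is an absolutely continuous function that satisfies the inclusion at almost every $t$. Set $v_-:=-R-\|\ell_d^-\|_{L^1(0,T)}$ and $v_+:=R+\|\ell_d^+\|_{L^1(0,T)}$. Then for every $x_0\in\mathbb{R}$ there is exactly one solution $x(\cdot\,;x_0)$ on $[0,T]$ with $x(0;x_0)=x_0$, so that the Poincaré map $\Phi_T(x_0):=x(T;x_0)$ is well defined on $\mathbb{R}$. There are real numbers $\alpha\le\beta$ such that $$K:=[\alpha,\beta]=\bigcap_{i\in\mathbb{N}}\Phi_T^i([v_-,v_+]),$$ and $K$ is a global attractor for the discrete dynamics induced by $\Phi_T$, that is, $K$ is nonempty and compact, $\Phi_T(K)=K$, and for every bounded $B\subset\mathbb{R}$ one has $\sup_{x\in B}\operatorname{dist}(\Phi_T^i(x),K)\to0$ as $i\to\infty$. Moreover $\Phi_T(\alpha)=\alpha$, $\Phi_T(\beta)=\beta$, and for every $v_0\in\mathbb{R}$ the sequence $\Phi_T^i(v_0)$ converges, as $i\to+\infty$, to some $v^*\in[\alpha,\beta]$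 with $\Phi_T(v^*)=v^*$. -/

import Mathlib

open MeasureTheory Set Filter Topology

/-- A set-valued map `F : ℝ → 𝒫(ℝ)` is monotone increasing. -/
def SetMonotone (F : ℝ → Set ℝ) : Prop :=
  ∀ u₁ u₂ : ℝ, u₁ ≠ u₂ → ∀ y₁ ∈ F u₁, ∀ y₂ ∈ F u₂, 0 ≤ (y₂ - y₁) * (u₂ - u₁)

/-- A set-valued map is maximal monotone increasing: it is monotone increasing, and every monotone
increasing map whose graph contains the graph of `F` is `F` itself. -/
def SetMaximalMonotone (F : ℝ → Set ℝ) : Prop :=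
  SetMonotone F ∧ ∀ F' : ℝ → Set ℝ, SetMonotone F' → (∀ u, F u ⊆ F' u) → F' = F

/-- (Lebesgue) measurability of a set-valued map of `t`: the preimage
`{t | F t ∩ U ≠ ∅}` of every open set is Lebesgue measurable. -/
def SetValuedMeasurable (F : ℝ → Set ℝ) : Prop :=
  ∀ U : Set ℝ, IsOpen U → NullMeasurableSet {t | (F t ∩ U).Nonempty} volume

/-- The assumptions on the monotone set-valued term `𝒜(t,u)`. -/
structure IsMonotoneTerm (T : ℝ) (A : ℝ → ℝ → Set ℝ) : Prop where
  nonempty : ∀ t u, (A t u).Nonempty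
  periodic : ∀ t u, A (t + T) u = A t u
  maximalMonotone : ∀ t, SetMaximalMonotone (A t)
  measurable : ∀ u, SetValuedMeasurable fun t => A t u
  /-- On every bounded set of `u`, the map is bounded by a locally integrable function of `t`. -/
  locallyBounded : ∀ r : ℝ, ∃ m : ℝ → ℝ, LocallyIntegrable m volume ∧
    ∀ᵐ t ∂volume, ∀ u, |u| ≤ r → ∀ y ∈ A t u, |y| ≤ m t

/-- The assumptions on the single-valued term `p(t,u)`: a Carathéodory function, `T`-periodic in
`t`, locally Lipschitz continuous in `u` uniformly in `t`. -/
structure IsRegularTerm (T : ℝ) (p : ℝ → ℝ → ℝ) : Prop where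
  periodic : ∀ t u, p (t + T) u = p t u
  measurable : ∀ u, AEMeasurable (fun t => p t u) volume
  continuous : ∀ t, Continuous (p t)
  locallyLipschitz : ∀ u₀ : ℝ, ∃ L : NNReal, ∃ U ∈ 𝓝 u₀, ∀ t, LipschitzOnWith L (p t) U

/-- The structural assumption (S1): `G(t,u) = -𝒜(t,u) + p(t,u)`. -/
def StructuralS1 (T : ℝ) (G : ℝ → ℝ → Set ℝ) : Prop :=
  ∃ (A : ℝ → ℝ → Set ℝ) (p : ℝ → ℝ → ℝ), IsMonotoneTerm T A ∧ IsRegularTerm T p ∧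
    ∀ t u, G t u = {y | ∃ a ∈ A t u, y = -a + p t u}

/-- The structural assumption (S2) with the data `R`, `ℓ_d^-`, `ℓ_d^+`. -/
structure StructuralS2 (T : ℝ) (G : ℝ → ℝ → Set ℝ) (R : ℝ) (lm lp : ℝ → ℝ) : Prop where
  R_pos : 0 < R
  periodic_lm : ∀ t, lm (t + T) = lm t
  periodic_lp : ∀ t, lp (t + T) = lp t
  integrable_lm : IntervalIntegrable lm volume 0 T
  integrable_lp : IntervalIntegrable lp volume 0 T
  integral_lm_neg : ∫ s in (0 : ℝ)..T, lm s < 0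
  integral_lp_neg : ∫ s in (0 : ℝ)..T, lp s < 0
  lower : ∀ᵐ t ∂volume, ∀ u, u ≤ -R → ∀ y ∈ G t u, -lm t ≤ y
  upper : ∀ᵐ t ∂volume, ∀ u, R ≤ u → ∀ y ∈ G t u, y ≤ lp t

/-- `v` is a solution of `v' ∈ G(t,v)` on `[a,b]`: it is absolutely continuous and satisfies the
inclusion at almost every time. -/
def IsSolutionOn (G : ℝ → ℝ → Set ℝ) (a b : ℝ) (v : ℝ → ℝ) : Prop :=
  AbsolutelyContinuousOnInterval v a b ∧
    ∀ᵐ t ∂volume, t ∈ Ioo a b → ∃ y ∈ G t (v t), HasDerivAt v y t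

/-- The Poincaré map `Φ_T`: the value at time `T` of a solution starting from `x₀` at time `0`
(an arbitrary value if there is no solution). -/
noncomputable def poincareMap (G : ℝ → ℝ → Set ℝ) (T : ℝ) (x₀ : ℝ) : ℝ :=
  Classical.epsilon fun y => ∃ v : ℝ → ℝ, IsSolutionOn G 0 T v ∧ v 0 = x₀ ∧ v T = y

/-- `v_- = -R - ‖ℓ_d^-‖_{L¹(0,T)}`. -/
noncomputable def vMinus (T R : ℝ) (lm : ℝ → ℝ) : ℝ := -R - ∫ s in (0 : ℝ)..T, |lm s|

/-- `v_+ = R + ‖ℓ_d^+‖_{L¹(0,T)}`. -/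
noncomputable def vPlus (T R : ℝ) (lp : ℝ → ℝ) : ℝ := R + ∫ s in (0 : ℝ)..T, |lp s|

/-- `K` is a global attractor for the iterates of `Φ`: it is nonempty, compact, invariant, and
attracts every bounded set uniformly. -/
structure IsGlobalAttractor (Φ : ℝ → ℝ) (K : Set ℝ) : Prop where
  nonempty : K.Nonempty
  compact : IsCompact K
  invariant : Φ '' K = K
  attracts : ∀ B : Set ℝ, Bornology.IsBounded B → ∀ ε > 0, ∀ᶠ i : ℕ in atTop,
    Φ^[i] '' B ⊆ Metric.thickening ε K

/-!
In one space dimension the right-hand side `G = -A + p` is one-sided Lipschitz on bounded sets: for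
`w < u` an element of `G (t, u)` exceeds an element of `G (t, w)` by at most `K (u - w)`. A Grönwall
inequality that uses a differential inequality only where the function is positive
(`le_exp_mul_of_deriv_le`) then gives comparison, uniqueness and Lipschitz dependence on the initial
value (`StructuralS2.exists_solution_sub_le`), and also the a priori bounds.

For existence, the selection `-sInf (A t u) + p t u` of `G` is measurable in `t` for each fixed `u`,
which is all that Euler polygons need. By the one-sided Lipschitz condition the polygons form a
uniformly Cauchy sequence. Their limit `v` satisfies `v' ≤ f (t, q) + K (v - q)` for rational
`q < v`, and the opposite inequality for `q > v` (`exists_generalized_solution`); letting `q` tend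
to `v`, maximality of `A` turns these inequalities into the inclusion
(`SetMaximalMonotone.neg_sub_mem_of_rat`). The bounds `-lm` and `lp` outside `[-R, R]` make
`p` integrable in time and confine solutions to a compact interval, so that `G` may be truncated.

The Poincaré map `Φ` is therefore increasing and continuous. Over one period a solution either stays
above `R`, and then loses at least `-∫ lp > 0`, or ends below `vPlus`
(`le_max_integral_of_dissipative`); hence `Φ x ≤ max vPlus (x + ∫ lp)`, and symmetrically from
below. For such a map of the line, `exists_attractor_of_monotone` concludes: the iterates of
`vMinus` increase and those of `vPlus` decrease to fixed points `α ≤ β`, every orbit is monotone, and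
bounded sets are eventually squeezed between the orbits of `vMinus` and `vPlus`.
-/

/-! ### Absolutely continuous functions with a differential inequality -/

theorem AbsolutelyContinuousOnInterval.sub_le_integral {g m : ℝ → ℝ} {a b : ℝ} (hab : a ≤ b)
    (hg : AbsolutelyContinuousOnInterval g a b) (hm : IntervalIntegrable m volume a b)
    (h : ∀ᵐ t, t ∈ Ioo a b → deriv g t ≤ m t) : g b - g a ≤ ∫ t in a..b, m t := by
  rw [← hg.integral_deriv_eq_sub]
  refine intervalIntegral.integral_mono_ae_restrict hab hg.intervalIntegrable_deriv hm ?_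
  rw [EventuallyLE, ← restrict_Ioo_eq_restrict_Icc, ae_restrict_iff' measurableSet_Ioo]
  exact h

/-- The increments of `v` are dominated by those of the primitive of `M`, which is absolutely
continuous. -/
theorem absolutelyContinuousOnInterval_of_abs_sub_le {v M : ℝ → ℝ} {a b : ℝ} (hab : a ≤ b)
    (hM : IntervalIntegrable M volume a b)
    (h : ∀ s ∈ Icc a b, ∀ t ∈ Icc a b, s ≤ t → |v t - v s| ≤ ∫ r in s..t, M r) :
    AbsolutelyContinuousOnInterval v a b := by
  have hF := hM.absolutelyContinuousOnInterval_intervalIntegral (c := a) left_mem_uIcc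
  have hsub : ∀ s ∈ Icc a b, IntervalIntegrable M volume a s := fun s hs =>
    hM.mono_set (by rw [uIcc_of_le hab, uIcc_of_le hs.1]; exact Icc_subset_Icc_right hs.2)
  have key : ∀ s ∈ Icc a b, ∀ t ∈ Icc a b, s ≤ t →
      dist (v s) (v t) ≤ dist (∫ r in a..s, M r) (∫ r in a..t, M r) := by
    intro s hs t ht hst
    have e : (∫ r in a..t, M r) - (∫ r in a..s, M r) = ∫ r in s..t, M r :=
      intervalIntegral.integral_interval_sub_left (hsub t ht) (hsub s hs)
    rw [dist_comm, dist_comm (∫ r in a..s, M r), Real.dist_eq, Real.dist_eq, e]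
    exact (h s hs t ht hst).trans (le_abs_self _)
  unfold AbsolutelyContinuousOnInterval at hF ⊢
  refine squeeze_zero' (Eventually.of_forall fun E => Finset.sum_nonneg fun i _ => dist_nonneg) ?_ hF
  filter_upwards [mem_inf_of_right (mem_principal_self _)] with E hE
  refine Finset.sum_le_sum fun i hi => ?_
  have hi' := hE.1 i hi
  rw [uIcc_of_le hab] at hi'
  rcases le_total (E.2 i).1 (E.2 i).2 with hle | hle
  · exact key _ hi'.1 _ hi'.2 hle
  · rw [dist_comm, dist_comm (∫ r in a..(E.2 i).1, M r)]
    exact key _ hi'.2 _ hi'.1 hle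

/-- The point `s` is the last one with `z s ≤ 0`, or `a` if there is none. -/
theorem exists_last_nonpos {z : ℝ → ℝ} {a b : ℝ} (hab : a ≤ b) (hz : ContinuousOn z (Icc a b)) :
    ∃ s ∈ Icc a b, z s ≤ max (z a) 0 ∧ ∀ t ∈ Ioc s b, 0 < z t := by
  by_cases hne : ∃ t ∈ Icc a b, z t ≤ 0
  · have hc : IsCompact (Icc a b ∩ z ⁻¹' Iic 0) :=
      isCompact_Icc.of_isClosed_subset (hz.preimage_isClosed_of_isClosed isClosed_Icc isClosed_Iic)
        inter_subset_left
    obtain ⟨s, hs, hmax⟩ := hc.exists_isGreatest (by obtain ⟨t, ht, ht0⟩ := hne; exact ⟨t, ht, ht0⟩)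
    refine ⟨s, hs.1, le_max_of_le_right hs.2, fun t ht => ?_⟩
    by_contra hcon
    exact absurd (hmax ⟨⟨hs.1.1.trans ht.1.le, ht.2⟩, not_lt.1 hcon⟩) (not_le.2 ht.1)
  · push Not at hne
    exact ⟨a, left_mem_Icc.2 hab, le_max_left _ _, fun t ht => hne t ⟨ht.1.le, ht.2⟩⟩

/-- A Grönwall inequality in which the differential inequality is required only where the function
is positive: going back from `b` to the last time at which `z ≤ 0` (or to `a`), the function
`exp (-L t) * z t` grows by at most `∫ m`. -/
theorem le_exp_mul_of_deriv_le {z m : ℝ → ℝ} {a b L : ℝ} (hab : a ≤ b) (hL : 0 ≤ L)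
    (hz : AbsolutelyContinuousOnInterval z a b) (hm : IntervalIntegrable m volume a b)
    (hm0 : ∀ t, 0 ≤ m t)
    (h : ∀ᵐ t, t ∈ Ioo a b → 0 < z t → deriv z t ≤ L * z t + m t) :
    z b ≤ Real.exp (L * (b - a)) * (max (z a) 0 + ∫ t in a..b, m t) := by
  obtain ⟨s, hs, hzs, hpos⟩ := exists_last_nonpos hab (by simpa [uIcc_of_le hab] using hz.continuousOn)
  have hsub : uIcc s b ⊆ uIcc a b := by
    rw [uIcc_of_le hab, uIcc_of_le hs.2]; exact Icc_subset_Icc_left hs.1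
  have hzs' := hz.mono hsub
  have hms := hm.mono_set hsub
  have hexp : AbsolutelyContinuousOnInterval (fun t => Real.exp (-L * (t - s))) s b := by
    apply ContDiffOn.absolutelyContinuousOnInterval
    fun_prop
  have hg := hexp.mul hzs'
  have hle := hg.sub_le_integral hs.2 hms (by
    filter_upwards [h, hzs'.ae_differentiableAt] with t ht hd htI
    have hdz := (hd (by rw [uIcc_of_le hs.2]; exact Ioo_subset_Icc_self htI)).hasDerivAt
    have hde : HasDerivAt (fun t => Real.exp (-L * (t - s))) (Real.exp (-L * (t - s)) * (-L * 1)) t :=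
      (((hasDerivAt_id t).sub_const s).const_mul (-L)).exp
    rw [(hde.mul hdz).deriv]
    have h1 := ht ⟨hs.1.trans_lt htI.1, htI.2⟩ (hpos t ⟨htI.1, htI.2.le⟩)
    have h2 : Real.exp (-L * (t - s)) ≤ 1 := by
      rw [Real.exp_le_one_iff]
      nlinarith [htI.1]
    have h3 := Real.exp_pos (-L * (t - s))
    nlinarith [hm0 t, mul_le_mul_of_nonneg_left h1 h3.le, mul_le_mul_of_nonneg_right h2 (hm0 t)])
  simp only [Pi.mul_apply, sub_self, mul_zero, Real.exp_zero, one_mul] at hle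
  have hint : ∫ t in s..b, m t ≤ ∫ t in a..b, m t :=
    intervalIntegral.integral_mono_interval hs.1 hs.2 le_rfl (ae_of_all _ hm0) hm
  have hint0 : 0 ≤ ∫ t in a..b, m t := intervalIntegral.integral_nonneg hab fun t _ => hm0 t
  have hzb : z b = Real.exp (L * (b - s)) * (Real.exp (-L * (b - s)) * z b) := by
    rw [← mul_assoc, ← Real.exp_add]; ring_nf; simp
  rw [hzb]
  calc Real.exp (L * (b - s)) * (Real.exp (-L * (b - s)) * z b)
      ≤ Real.exp (L * (b - s)) * (max (z a) 0 + ∫ t in a..b, m t) := by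
        gcongr; linarith
    _ ≤ _ := by
        have : 0 ≤ max (z a) 0 := le_max_right _ _
        gcongr
        exact hs.1

/-! ### Existence for one-sided Lipschitz right-hand sides -/

/-- Only measurability of `f (·, u)` for constant `u` is needed to substitute a step function. -/
theorem aemeasurable_comp_floor {f : ℝ → ℝ → ℝ} (hf : ∀ u, AEMeasurable (fun t => f t u) volume)
    (X : ℕ → ℝ) (h : ℝ) : AEMeasurable (fun s => f s (X ⌊s / h⌋₊)) volume := by
  refine ⟨fun s => (hf (X ⌊s / h⌋₊)).mk _ s, ?_, ?_⟩
  · have : Measurable fun q : ℝ × ℕ => (hf (X q.2)).mk _ q.1 :=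
      measurable_from_prod_countable_left fun n => (hf (X n)).measurable_mk
    exact this.comp (measurable_id.prodMk (Nat.measurable_floor.comp (measurable_id.div_const h)))
  · filter_upwards [ae_all_iff.2 fun n => (hf (X n)).ae_eq_mk] with s hs
    exact hs _

theorem integrable_comp_floor {f : ℝ → ℝ → ℝ} {M : ℝ → ℝ}
    (hf : ∀ u, AEMeasurable (fun t => f t u) volume) (hM : Integrable M volume)
    (hb : ∀ᵐ t, ∀ u, |f t u| ≤ M t)
    (X : ℕ → ℝ) (h : ℝ) : Integrable (fun s => f s (X ⌊s / h⌋₊)) volume :=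
  hM.mono' (aemeasurable_comp_floor hf X h).aestronglyMeasurable
    (by filter_upwards [hb] with t ht using ht _)

theorem abs_integral_comp_le {f : ℝ → ℝ → ℝ} {M w : ℝ → ℝ} (hM : Integrable M volume)
    (hb : ∀ᵐ t, ∀ u, |f t u| ≤ M t) {s t : ℝ} (hst : s ≤ t) :
    |∫ r in s..t, f r (w r)| ≤ ∫ r in s..t, M r := by
  rw [← Real.norm_eq_abs]
  refine intervalIntegral.norm_integral_le_of_norm_le hst ?_ hM.intervalIntegrable
  filter_upwards [hb] with r hr _ using hr _

/-- Euler polygons: for each `ε` there are a step function `w` and a primitive `v` of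
`f (·, w ·)` starting at `x₀` and `ε`-close to `w` on `[0, T]`. -/
theorem exists_euler_polygon {f : ℝ → ℝ → ℝ} {M : ℝ → ℝ}
    (hf : ∀ u, AEMeasurable (fun t => f t u) volume) (hM : Integrable M volume)
    (hb : ∀ᵐ t, ∀ u, |f t u| ≤ M t) (T x₀ : ℝ) {ε : ℝ} (hε : 0 < ε) :
    ∃ w : ℝ → ℝ, Integrable (fun s => f s (w s)) volume ∧
      ∀ t ∈ Icc 0 T, |x₀ + (∫ s in (0 : ℝ)..t, f s (w s)) - w t| ≤ ε := by
  have hFc : ContinuousOn (fun t => ∫ s in (0 : ℝ)..t, M s) (Icc 0 T) :=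
    (intervalIntegral.continuous_primitive (fun a b => hM.intervalIntegrable) 0).continuousOn
  obtain ⟨δ, hδ, hF⟩ := Metric.uniformContinuousOn_iff.1
    (isCompact_Icc.uniformContinuousOn_of_continuous hFc) ε hε
  set h := δ / 2 with hh
  have hh0 : 0 < h := by positivity
  -- The values at the nodes `k * h`.
  let X : ℕ → ℝ := fun n => Nat.rec x₀ (fun k x => x + ∫ s in (k * h)..((k + 1 : ℕ) * h), f s x) n
  have hX : ∀ k, X (k + 1) = X k + ∫ s in (k * h)..((k + 1 : ℕ) * h), f s (X k) := fun k => rfl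
  have hI := integrable_comp_floor hf hM hb X h
  have hnode : ∀ k : ℕ, x₀ + (∫ s in (0 : ℝ)..(k * h), f s (X ⌊s / h⌋₊)) = X k := by
    intro k
    induction k with
    | zero => simp [X]
    | succ k ih =>
      rw [hX, ← ih, ← intervalIntegral.integral_add_adjacent_intervals (b := k * h)
        hI.intervalIntegrable hI.intervalIntegrable, ← add_assoc, ih]
      congr 1
      have hle : (k : ℝ) * h ≤ (k + 1 : ℕ) * h := by push_cast; nlinarith
      refine intervalIntegral.integral_congr_ae ?_
      have hne : ∀ᵐ s : ℝ, s ≠ (k + 1 : ℕ) * h := by simp [ae_iff, measure_singleton]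
      filter_upwards [hne] with s hs hsI
      rw [uIoc_of_le hle] at hsI
      have : ⌊s / h⌋₊ = k := by
        rw [Nat.floor_eq_iff (div_nonneg (le_trans (by positivity) hsI.1.le) hh0.le),
          le_div_iff₀ hh0, div_lt_iff₀ hh0]
        refine ⟨hsI.1.le, ?_⟩
        have := lt_of_le_of_ne hsI.2 hs
        push_cast at this
        exact this
      rw [this]
  refine ⟨fun s => X ⌊s / h⌋₊, hI, fun t ht => ?_⟩
  have hk1 : (⌊t / h⌋₊ : ℝ) * h ≤ t := by
    rw [← le_div_iff₀ hh0]; exact Nat.floor_le (div_nonneg ht.1 hh0.le)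
  have hk2 : t < (⌊t / h⌋₊ + 1 : ℝ) * h := by
    rw [← div_lt_iff₀ hh0]; exact Nat.lt_floor_add_one _
  have hk0 : (0 : ℝ) ≤ (⌊t / h⌋₊ : ℝ) * h := by positivity
  beta_reduce
  rw [← hnode ⌊t / h⌋₊]
  have e : ∀ g : ℝ → ℝ, Integrable g volume → (∫ s in (0 : ℝ)..t, g s) -
      (∫ s in (0 : ℝ)..(⌊t / h⌋₊ * h), g s) = ∫ s in (⌊t / h⌋₊ * h)..t, g s := fun g hg =>
    intervalIntegral.integral_interval_sub_left hg.intervalIntegrable hg.intervalIntegrable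
  rw [add_sub_add_left_eq_sub, e _ hI]
  refine (abs_integral_comp_le (w := fun s => X ⌊s / h⌋₊) hM hb hk1).trans ?_
  have := hF t ht (⌊t / h⌋₊ * h) ⟨hk0, hk1.trans ht.2⟩ (by
    rw [Real.dist_eq, abs_of_nonneg (by linarith)]; linarith)
  rw [Real.dist_eq, e _ hM] at this
  exact (le_abs_self _).trans this.le

/-- Two Euler polygons of accuracy `ε` differ by a multiple of `ε`. -/
theorem euler_polygon_sub_le {f : ℝ → ℝ → ℝ} {L T x₀ ε : ℝ} {w₁ w₂ : ℝ → ℝ} (hL : 0 ≤ L)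
    (hε : 0 ≤ ε) (hos : ∀ t u w, w ≤ u → f t u - f t w ≤ L * (u - w))
    (hw₁ : Integrable (fun s => f s (w₁ s)) volume) (hw₂ : Integrable (fun s => f s (w₂ s)) volume)
    (h₁ : ∀ t ∈ Icc 0 T, |x₀ + (∫ s in (0 : ℝ)..t, f s (w₁ s)) - w₁ t| ≤ ε)
    (h₂ : ∀ t ∈ Icc 0 T, |x₀ + (∫ s in (0 : ℝ)..t, f s (w₂ s)) - w₂ t| ≤ ε)
    {t : ℝ} (ht : t ∈ Icc 0 T) :
    (∫ s in (0 : ℝ)..t, f s (w₁ s)) - (∫ s in (0 : ℝ)..t, f s (w₂ s)) ≤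
      (2 + Real.exp (L * T) * (4 * L * T)) * ε := by
  -- Where `z > 0` the step functions are ordered, so that the one-sided Lipschitz bound applies.
  set z : ℝ → ℝ := fun t => (∫ s in (0 : ℝ)..t, f s (w₁ s)) - (∫ s in (0 : ℝ)..t, f s (w₂ s)) - 2 * ε
    with hz
  have hac : AbsolutelyContinuousOnInterval z 0 t :=
    ((hw₁.intervalIntegrable.absolutelyContinuousOnInterval_intervalIntegral left_mem_uIcc).sub
      (hw₂.intervalIntegrable.absolutelyContinuousOnInterval_intervalIntegral left_mem_uIcc)).sub
      (contDiffOn_const.absolutelyContinuousOnInterval)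
  have hg := le_exp_mul_of_deriv_le (m := fun _ => 4 * L * ε) ht.1 hL hac
    (by simp) (fun _ => by positivity) (by
      filter_upwards [LocallyIntegrable.ae_hasDerivAt_integral hw₁.locallyIntegrable,
        LocallyIntegrable.ae_hasDerivAt_integral hw₂.locallyIntegrable] with s hs₁ hs₂ hsI hzs
      have hd : HasDerivAt z (f s (w₁ s) - f s (w₂ s)) s :=
        ((hs₁ 0).sub (hs₂ 0)).sub_const (2 * ε)
      rw [hd.deriv]
      have b₁ := abs_le.1 (h₁ s ⟨hsI.1.le, hsI.2.le.trans ht.2⟩)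
      have b₂ := abs_le.1 (h₂ s ⟨hsI.1.le, hsI.2.le.trans ht.2⟩)
      simp only [hz] at hzs ⊢
      have := hos s (w₁ s) (w₂ s) (by linarith)
      have h3 : w₁ s - w₂ s ≤ ((∫ s in (0 : ℝ)..s, f s (w₁ s)) -
        (∫ s in (0 : ℝ)..s, f s (w₂ s)) - 2 * ε) + 4 * ε := by linarith
      nlinarith [mul_le_mul_of_nonneg_left h3 hL])
  have h0 : max (z 0) 0 = 0 := max_eq_right (by simp [hz, hε])
  rw [h0] at hg
  simp only [hz, intervalIntegral.integral_const, smul_eq_mul, sub_zero, zero_add] at hg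
  have h4 : Real.exp (L * t) * (t * (4 * L * ε)) ≤ Real.exp (L * T) * (T * (4 * L * ε)) := by
    have := ht.1
    have := ht.2
    gcongr
  nlinarith

/-- Passing to the limit in the Euler polygons, above a level `u`: the one-sided Lipschitz condition
bounds the increments of the limit by the integral of `f (·, u)` plus a correction. -/
theorem euler_limit_sub_le {f : ℝ → ℝ → ℝ} {M v : ℝ → ℝ} {w : ℕ → ℝ → ℝ} {e : ℕ → ℝ} {L T : ℝ}
    (hL : 0 ≤ L)
    (hf : ∀ u, AEMeasurable (fun t => f t u) volume) (hM : Integrable M volume)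
    (hb : ∀ᵐ t, ∀ u, |f t u| ≤ M t)
    (hos : ∀ t u w, w ≤ u → f t u - f t w ≤ L * (u - w))
    (hw : ∀ n, Integrable (fun s => f s (w n s)) volume)
    (he : Tendsto e atTop (𝓝 0))
    (hwv : ∀ n, ∀ t ∈ Icc 0 T, |w n t - v t| ≤ e n)
    (hlim : ∀ s ∈ Icc 0 T, ∀ t ∈ Icc 0 T,
      Tendsto (fun n => ∫ r in s..t, f r (w n r)) atTop (𝓝 (v t - v s)))
    (hv : ContinuousOn v (Icc 0 T)) {u s t : ℝ} (hst : s ≤ t) (hs : 0 ≤ s) (ht : t ≤ T)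
    (hu : ∀ r ∈ Icc s t, u < v r) :
    v t - v s ≤ ∫ r in s..t, (f r u + L * (v r - u)) := by
  have hvst := hv.mono (Icc_subset_Icc hs ht)
  obtain ⟨r₀, hr₀, hmin⟩ := isCompact_Icc.exists_isMinOn (nonempty_Icc.2 hst) hvst
  have hvi : IntervalIntegrable v volume s t := (by simpa [uIcc_of_le hst] using hvst :
    ContinuousOn v (uIcc s t)).intervalIntegrable
  have hfi : Integrable (fun r => f r u) volume := hM.mono' (hf u).aestronglyMeasurable
    (by filter_upwards [hb] with t ht using ht _)
  have hgi : IntervalIntegrable (fun r => f r u + L * (v r - u)) volume s t :=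
    hfi.intervalIntegrable.add ((hvi.sub intervalIntegrable_const).const_mul L)
  have hlim2 : Tendsto (fun n => (∫ r in s..t, (f r u + L * (v r - u))) + (t - s) * (L * e n)) atTop
      (𝓝 ((∫ r in s..t, (f r u + L * (v r - u))) + (t - s) * (L * 0))) :=
    tendsto_const_nhds.add ((he.const_mul L).const_mul _)
  rw [mul_zero, mul_zero, add_zero] at hlim2
  refine le_of_tendsto_of_tendsto (hlim s ⟨hs, hst.trans ht⟩ t ⟨hs.trans hst, ht⟩) hlim2 ?_
  filter_upwards [he.eventually (gt_mem_nhds (sub_pos.2 (hu r₀ hr₀)))] with n hn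
  have e1 : (∫ r in s..t, (f r u + L * (v r - u))) + (t - s) * (L * e n) =
      ∫ r in s..t, (f r u + L * (v r - u) + L * e n) := by
    rw [intervalIntegral.integral_add hgi intervalIntegrable_const]; simp; ring
  rw [e1]
  refine intervalIntegral.integral_mono_on hst (hw n).intervalIntegrable
    (hgi.add intervalIntegrable_const) fun r hr => ?_
  have h1 := abs_le.1 (hwv n r ⟨hs.trans hr.1, hr.2.trans ht⟩)
  have h2 : v r₀ ≤ v r := hmin hr
  have h3 := hos r (w n r) u (by linarith)
  nlinarith

theorem le_of_hasDerivAt_of_eventually_sub_le {v H : ℝ → ℝ} {y h t : ℝ} (hv : HasDerivAt v y t)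
    (hH : HasDerivAt H h t) (hle : ∀ᶠ s in 𝓝[>] t, v s - v t ≤ H s - H t) : y ≤ h := by
  have h1 := (hasDerivWithinAt_iff_tendsto_slope' (by simp)).1 (hv.hasDerivWithinAt (s := Ioi t))
  have h2 := (hasDerivWithinAt_iff_tendsto_slope' (by simp)).1 (hH.hasDerivWithinAt (s := Ioi t))
  refine le_of_tendsto_of_tendsto h1 h2 ?_
  filter_upwards [hle, self_mem_nhdsWithin] with s hs hts
  rw [slope_def_field, slope_def_field]
  exact div_le_div_of_nonneg_right hs (sub_nonneg.2 (le_of_lt hts))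

/-- Differentiates the integral inequality at the Lebesgue points of `g`; by continuity `v > u` near
any time at which `v > u`. -/
theorem ae_hasDerivAt_le_of_sub_le_integral {v g : ℝ → ℝ} {u T : ℝ} (hT : 0 ≤ T)
    (hv : ContinuousOn v (Icc 0 T)) (hg : IntervalIntegrable g volume 0 T)
    (h : ∀ s t, s ≤ t → 0 ≤ s → t ≤ T → (∀ r ∈ Icc s t, u < v r) → v t - v s ≤ ∫ r in s..t, g r) :
    ∀ᵐ t, t ∈ Ioo 0 T → u < v t → ∀ y, HasDerivAt v y t → y ≤ g t := by
  filter_upwards [hg.ae_hasDerivAt_integral] with t ht htI hut y hy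
  have htc : t ∈ uIcc 0 T := by rw [uIcc_of_le hT]; exact Ioo_subset_Icc_self htI
  refine le_of_hasDerivAt_of_eventually_sub_le hy (ht htc t htc) ?_
  have hca : ContinuousAt v t := hv.continuousAt (Icc_mem_nhds htI.1 htI.2)
  obtain ⟨δ, hδ, hδ'⟩ := Metric.eventually_nhds_iff.1 (hca.eventually (lt_mem_nhds hut))
  have h1 : ∀ᶠ s in 𝓝[>] t, s < min (t + δ) T :=
    eventually_nhdsWithin_of_eventually_nhds (gt_mem_nhds (lt_min (by linarith) htI.2))
  filter_upwards [h1, self_mem_nhdsWithin] with s hs hts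
  rw [intervalIntegral.integral_same, sub_zero]
  obtain ⟨hs1, hs2⟩ := lt_min_iff.1 hs
  refine h t s (le_of_lt hts) htI.1.le hs2.le fun r hr => hδ' ?_
  rw [Real.dist_eq, abs_of_nonneg (by linarith [hr.1])]
  linarith [hr.2]

/-- Existence for a right-hand side `f` that is measurable in time, bounded by an integrable
function of time and one-sided Lipschitz, but possibly discontinuous, in space. At almost every
time the derivative of `v` is compatible with the values of `f` at all rational levels, which is
the equation in the sense of Filippov. -/
theorem exists_generalized_solution {f : ℝ → ℝ → ℝ} {M : ℝ → ℝ} {L T : ℝ} (hL : 0 ≤ L) (hT : 0 < T)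
    (hf : ∀ u, AEMeasurable (fun t => f t u) volume) (hM : Integrable M volume)
    (hb : ∀ᵐ t, ∀ u, |f t u| ≤ M t)
    (hos : ∀ t u w, w ≤ u → f t u - f t w ≤ L * (u - w)) (x₀ : ℝ) :
    ∃ v : ℝ → ℝ, v 0 = x₀ ∧ AbsolutelyContinuousOnInterval v 0 T ∧
      ∀ᵐ t, t ∈ Ioo 0 T → ∃ y, HasDerivAt v y t ∧ ∀ q : ℚ,
        ((q : ℝ) < v t → y ≤ f t q + L * (v t - q)) ∧
        (v t < (q : ℝ) → f t q - L * (q - v t) ≤ y) := by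
  have hε : ∀ n : ℕ, (0 : ℝ) < 1 / ((n : ℝ) + 1) := fun n => Nat.one_div_pos_of_nat
  choose w hw hwε using fun n : ℕ => exists_euler_polygon hf hM hb T x₀ (hε n)
  set C := 2 + Real.exp (L * T) * (4 * L * T) with hC
  set V : ℕ → ℝ → ℝ := fun n t => x₀ + ∫ s in (0 : ℝ)..t, f s (w n s) with hV
  have hanti : ∀ n m : ℕ, n ≤ m → (1 : ℝ) / ((m : ℝ) + 1) ≤ 1 / ((n : ℝ) + 1) := fun n m hnm =>
    Nat.one_div_le_one_div hnm
  have hdist : ∀ t ∈ Icc 0 T, ∀ n m : ℕ, n ≤ m → dist (V n t) (V m t) ≤ C * (1 / ((n : ℝ) + 1)) := by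
    intro t ht n m hnm
    have hm' : ∀ t ∈ Icc 0 T, |x₀ + (∫ s in (0 : ℝ)..t, f s (w m s)) - w m t| ≤ 1 / ((n : ℝ) + 1) :=
      fun t ht => (hwε m t ht).trans (hanti n m hnm)
    have h1 := euler_polygon_sub_le hL (hε n).le hos (hw n) (hw m) (hwε n) hm' ht
    have h2 := euler_polygon_sub_le hL (hε n).le hos (hw m) (hw n) hm' (hwε n) ht
    rw [Real.dist_eq, abs_le]
    constructor <;> simp only [hV] <;> linarith
  have hε0 : Tendsto (fun n : ℕ => (1 : ℝ) / ((n : ℝ) + 1)) atTop (𝓝 0) :=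
    tendsto_one_div_add_atTop_nhds_zero_nat
  have hCε : Tendsto (fun n : ℕ => C * ((1 : ℝ) / ((n : ℝ) + 1))) atTop (𝓝 0) := by
    simpa using hε0.const_mul C
  have hex : ∀ t, ∃ x, t ∈ Icc 0 T → Tendsto (fun n => V n t) atTop (𝓝 x) := by
    intro t
    by_cases ht : t ∈ Icc 0 T
    · obtain ⟨x, hx⟩ := cauchySeq_tendsto_of_complete
        (cauchySeq_of_le_tendsto_0' _ (hdist t ht) hCε)
      exact ⟨x, fun _ => hx⟩
    · exact ⟨0, fun h => absurd h ht⟩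
  choose v hv using hex
  have hVv : ∀ n, ∀ t ∈ Icc 0 T, dist (V n t) (v t) ≤ C * (1 / ((n : ℝ) + 1)) := fun n t ht =>
    le_of_tendsto (tendsto_const_nhds.dist (hv t ht))
      (eventually_atTop.2 ⟨n, fun m hm => hdist t ht n m hm⟩)
  have hlim : ∀ s ∈ Icc 0 T, ∀ t ∈ Icc 0 T,
      Tendsto (fun n => ∫ r in s..t, f r (w n r)) atTop (𝓝 (v t - v s)) := by
    intro s hs t ht
    refine ((hv t ht).sub (hv s hs)).congr fun n => ?_
    simp only [hV, add_sub_add_left_eq_sub]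
    exact intervalIntegral.integral_interval_sub_left (hw n).intervalIntegrable
      (hw n).intervalIntegrable
  have hv0 : v 0 = x₀ :=
    tendsto_nhds_unique (hv 0 ⟨le_rfl, hT.le⟩) (by simp [hV])
  have hac : AbsolutelyContinuousOnInterval v 0 T :=
    absolutelyContinuousOnInterval_of_abs_sub_le hT.le hM.intervalIntegrable fun s hs t ht hst =>
      le_of_tendsto (hlim s hs t ht).abs
        (Eventually.of_forall fun n => abs_integral_comp_le hM hb hst)
  have hvc : ContinuousOn v (Icc 0 T) := by simpa [uIcc_of_le hT.le] using hac.continuousOn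
  set e : ℕ → ℝ := fun n => C * (1 / ((n : ℝ) + 1)) + 1 / ((n : ℝ) + 1) with hedef
  have he : Tendsto e atTop (𝓝 0) := by simpa only [add_zero] using hCε.add hε0
  have hwv : ∀ n, ∀ t ∈ Icc 0 T, |w n t - v t| ≤ e n := by
    intro n t ht
    have h1 := hVv n t ht
    have h2 := hwε n t ht
    rw [Real.dist_eq, abs_le] at h1
    rw [abs_le] at h2 ⊢
    simp only [hV, hedef] at h1 ⊢
    constructor <;> linarith
  have hgi : ∀ u, IntervalIntegrable (fun r => f r u + L * (v r - u)) volume 0 T := by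
    intro u
    have hfi : Integrable (fun r => f r u) volume := hM.mono' (hf u).aestronglyMeasurable
      (by filter_upwards [hb] with t ht using ht _)
    exact hfi.intervalIntegrable.add
      ((hac.continuousOn.intervalIntegrable.sub intervalIntegrable_const).const_mul L)
  have hup : ∀ q : ℚ, ∀ᵐ t, t ∈ Ioo 0 T → (q : ℝ) < v t → ∀ y, HasDerivAt v y t →
      y ≤ f t q + L * (v t - q) := fun q =>
    ae_hasDerivAt_le_of_sub_le_integral hT.le hvc (hgi q) fun s t hst hs ht hu =>
      euler_limit_sub_le hL hf hM hb hos hw he hwv hlim hvc hst hs ht hu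
  -- The lower bound is the upper bound for the reflected right-hand side `-f (t, -u)`.
  have hlow : ∀ q : ℚ, ∀ᵐ t, t ∈ Ioo 0 T → (-q : ℝ) < -v t → ∀ y, HasDerivAt (fun t => -v t) y t →
      y ≤ -(f t q + L * (v t - q)) := by
    intro q
    refine ae_hasDerivAt_le_of_sub_le_integral hT.le hvc.neg (hgi q).neg fun s t hst hs ht hu => ?_
    have := euler_limit_sub_le (f := fun t u => -f t (-u)) (v := fun t => -v t)
      (w := fun n t => -w n t) (e := e) (u := -q) (M := M) hL (fun u => (hf (-u)).neg) hM
      (by filter_upwards [hb] with t ht u; simpa using ht (-u))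
      (fun t u w hwu => by have := hos t (-w) (-u) (by linarith); linarith)
      (fun n => by simpa using (hw n).neg) he
      (fun n t ht => by rw [← abs_neg]; convert hwv n t ht using 2; ring)
      (fun s hs t ht => by
        have := (hlim s hs t ht).neg
        simp only [neg_neg, intervalIntegral.integral_neg]
        convert this using 2; ring)
      hvc.neg hst hs ht hu
    refine this.trans_eq (intervalIntegral.integral_congr fun r _ => ?_)
    simp only [neg_neg]; ring
  refine ⟨v, hv0, hac, ?_⟩
  filter_upwards [ae_all_iff.2 hup, ae_all_iff.2 hlow, hac.ae_differentiableAt] with t h1 h2 h3 htI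
  have hd := (h3 (by rw [uIcc_of_le hT.le]; exact Ioo_subset_Icc_self htI)).hasDerivAt
  refine ⟨_, hd, fun q => ⟨fun hq => h1 q htI hq _ hd, fun hq => ?_⟩⟩
  have := h2 q htI (by linarith) _ hd.neg
  linarith

/-! ### Growth bounds over one period -/

theorem le_max_add_integral_abs {z l : ℝ → ℝ} {R a b : ℝ} (hab : a ≤ b)
    (hz : AbsolutelyContinuousOnInterval z a b) (hl : IntervalIntegrable l volume a b)
    (h : ∀ᵐ t, t ∈ Ioo a b → R < z t → deriv z t ≤ l t) :
    z b ≤ max (z a) R + ∫ t in a..b, |l t| := by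
  have hac : AbsolutelyContinuousOnInterval (fun t => z t - R) a b :=
    hz.sub contDiffOn_const.absolutelyContinuousOnInterval
  have := le_exp_mul_of_deriv_le hab le_rfl hac hl.abs (fun t => abs_nonneg _) (by
    filter_upwards [h] with t ht htI hpos
    rw [deriv_sub_const, zero_mul, zero_add]
    exact (ht htI (by linarith)).trans (le_abs_self _))
  simp only [zero_mul, Real.exp_zero, one_mul] at this
  have e : max (z a - R) 0 = max (z a) R - R := by
    rw [← max_sub_sub_right, sub_self]
  linarith

theorem le_max_add_integral_abs_of_mem {z l : ℝ → ℝ} {R T : ℝ}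
    (hz : AbsolutelyContinuousOnInterval z 0 T) (hl : IntervalIntegrable l volume 0 T)
    (h : ∀ᵐ t, t ∈ Ioo 0 T → R < z t → deriv z t ≤ l t) {s t : ℝ} (hs : 0 ≤ s) (hst : s ≤ t)
    (ht : t ≤ T) : z t ≤ max (z s) R + ∫ r in (0 : ℝ)..T, |l r| := by
  have hsub : uIcc s t ⊆ uIcc 0 T := by
    rw [uIcc_of_le hst, uIcc_of_le (hs.trans (hst.trans ht))]; exact Icc_subset_Icc hs ht
  have h1 := le_max_add_integral_abs hst (hz.mono hsub) (hl.mono_set hsub)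
    (by filter_upwards [h] with r hr hrI using hr ⟨hs.trans_lt hrI.1, hrI.2.trans_le ht⟩)
  have h2 : ∫ r in s..t, |l r| ≤ ∫ r in (0 : ℝ)..T, |l r| :=
    intervalIntegral.integral_mono_interval hs hst ht (ae_of_all _ fun _ => abs_nonneg _) hl.abs
  linarith

/-- Over one period, a function whose derivative is at most `l` above the level `R` either stays
above `R` and grows by at most `∫ l`, or ends below `R + ∫ |l|`. -/
theorem le_max_integral_of_dissipative {z l : ℝ → ℝ} {R T : ℝ} (hT : 0 ≤ T)
    (hz : AbsolutelyContinuousOnInterval z 0 T) (hl : IntervalIntegrable l volume 0 T)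
    (h : ∀ᵐ t, t ∈ Ioo 0 T → R < z t → deriv z t ≤ l t) :
    z T ≤ max (R + ∫ r in (0 : ℝ)..T, |l r|) (z 0 + ∫ r in (0 : ℝ)..T, l r) := by
  by_cases hex : ∃ s ∈ Icc 0 T, z s ≤ R
  · obtain ⟨s, hs, hsR⟩ := hex
    have := le_max_add_integral_abs_of_mem hz hl h hs.1 hs.2 le_rfl
    rw [max_eq_right hsR] at this
    exact le_max_of_le_left this
  · push Not at hex
    have := hz.sub_le_integral hT hl
      (by filter_upwards [h] with t ht htI using ht htI (hex t (Ioo_subset_Icc_self htI)))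
    exact le_max_of_le_right (by linarith)

/-! ### Maximal monotone set-valued maps on the line -/

/-- By maximality, `y` belongs to `F u` as soon as adding `(u, y)` keeps the graph monotone. -/
theorem SetMaximalMonotone.mem_of_forall {F : ℝ → Set ℝ} (hF : SetMaximalMonotone F) {u y : ℝ}
    (h : ∀ u', u' ≠ u → ∀ y' ∈ F u', 0 ≤ (y' - y) * (u' - u)) : y ∈ F u := by
  have := hF.2 (fun x => F x ∪ {z | x = u ∧ z = y}) ?_ fun _ => subset_union_left
  · rw [← this]
    exact Or.inr ⟨rfl, rfl⟩
  · rintro u₁ u₂ hne y₁ (h₁ | ⟨rfl, rfl⟩) y₂ (h₂ | ⟨rfl, rfl⟩)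
    · exact hF.1 u₁ u₂ hne y₁ h₁ y₂ h₂
    · have := h u₁ hne y₁ h₁
      linarith
    · exact h u₂ hne.symm y₂ h₂
    · exact absurd rfl hne

theorem SetMonotone.le_of_lt {F : ℝ → Set ℝ} (hF : SetMonotone F) {u w a b : ℝ} (huw : u < w)
    (ha : a ∈ F u) (hb : b ∈ F w) : a ≤ b := by
  have := hF u w huw.ne a ha b hb
  by_contra hcon
  nlinarith [mul_pos (sub_pos.2 (not_le.1 hcon)) (sub_pos.2 huw)]

theorem SetMonotone.bddBelow {F : ℝ → Set ℝ} (hF : SetMonotone F) (hne : ∀ u, (F u).Nonempty)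
    (u : ℝ) : BddBelow (F u) := by
  obtain ⟨y, hy⟩ := hne (u - 1)
  exact ⟨y, fun z hz => hF.le_of_lt (by linarith) hy hz⟩

/-- The values of a maximal monotone map have a least element, which serves as a selection. -/
theorem SetMaximalMonotone.sInf_mem {F : ℝ → Set ℝ} (hF : SetMaximalMonotone F)
    (hne : ∀ u, (F u).Nonempty) (u : ℝ) : sInf (F u) ∈ F u := by
  refine hF.mem_of_forall fun u' hu' y' hy' => ?_
  rcases lt_or_gt_of_ne hu' with hlt | hlt
  · exact mul_nonneg_of_nonpos_of_nonpos
      (sub_nonpos.2 (le_csInf (hne u) fun z hz => hF.1.le_of_lt hlt hy' hz)) (by linarith)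
  · obtain ⟨z, hz⟩ := hne u
    exact mul_nonneg (sub_nonneg.2 ((csInf_le (hF.1.bddBelow hne u) hz).trans
      (hF.1.le_of_lt hlt hz hy'))) (by linarith)

theorem SetValuedMeasurable.aemeasurable_sInf {F : ℝ → Set ℝ} (hF : SetValuedMeasurable F)
    (hne : ∀ t, (F t).Nonempty) (hbdd : ∀ t, BddBelow (F t)) :
    AEMeasurable (fun t => sInf (F t)) volume := by
  refine NullMeasurable.aemeasurable fun s hs => ?_
  have : Measurable[_] (fun t : NullMeasurableSpace ℝ volume => sInf (F t)) := by
    refine measurable_of_Iio fun c => ?_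
    have e : (fun t => sInf (F t)) ⁻¹' Iio c = {t | (F t ∩ Iio c).Nonempty} := by
      ext t
      simp only [mem_preimage, mem_Iio, mem_ofPred_eq, csInf_lt_iff (hbdd t) (hne t)]
      rfl
    change NullMeasurableSet ((fun t => sInf (F t)) ⁻¹' Iio c) volume
    rw [e]
    exact hF _ isOpen_Iio
  exact this hs

/-! ### The regular term -/

theorem LipschitzOnWith.Icc_union {f : ℝ → ℝ} {K₁ K₂ : NNReal} {a b c : ℝ}
    (h₁ : LipschitzOnWith K₁ f (Icc a b)) (h₂ : LipschitzOnWith K₂ f (Icc b c)) :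
    LipschitzOnWith (max K₁ K₂) f (Icc a c) := by
  have h₁' := h₁.weaken (le_max_left K₁ K₂)
  have h₂' := h₂.weaken (le_max_right K₁ K₂)
  have key : ∀ x ∈ Icc a c, ∀ y ∈ Icc a c, x ≤ y → dist (f x) (f y) ≤ max K₁ K₂ * dist x y := by
    intro x hx y hy hxy
    rcases le_total y b with hyb | hyb
    · exact h₁'.dist_le_mul x ⟨hx.1, hxy.trans hyb⟩ y ⟨hy.1, hyb⟩
    rcases le_total b x with hxb | hxb
    · exact h₂'.dist_le_mul x ⟨hxb, hx.2⟩ y ⟨hyb, hy.2⟩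
    have e1 := h₁'.dist_le_mul x ⟨hx.1, hxb⟩ b ⟨hx.1.trans hxb, le_rfl⟩
    have e2 := h₂'.dist_le_mul b ⟨le_rfl, hyb.trans hy.2⟩ y ⟨hyb, hy.2⟩
    have e3 : dist x y = dist x b + dist b y := by
      rw [Real.dist_eq, Real.dist_eq, Real.dist_eq, abs_of_nonpos (by linarith),
        abs_of_nonpos (by linarith), abs_of_nonpos (by linarith)]
      ring
    rw [e3, mul_add]
    exact (dist_triangle _ _ _).trans (add_le_add e1 e2)
  refine LipschitzOnWith.of_dist_le_mul fun x hx y hy => ?_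
  rcases le_total x y with hxy | hxy
  · exact key x hx y hy hxy
  · rw [dist_comm, dist_comm x]
    exact key y hy x hx hxy

/-- The interval is cut into finitely many pieces, each inside one of the given neighbourhoods. -/
theorem exists_lipschitzOnWith_Icc_of_locally {p : ℝ → ℝ → ℝ}
    (h : ∀ u₀ : ℝ, ∃ L : NNReal, ∃ U ∈ 𝓝 u₀, ∀ t, LipschitzOnWith L (p t) U) {a b : ℝ}
    (hab : a ≤ b) : ∃ K : NNReal, ∀ t, LipschitzOnWith K (p t) (Icc a b) := by
  choose L U hU hLU using h
  obtain ⟨s, hs0, hsm, ⟨m, hm⟩, hsub⟩ := exists_monotone_Icc_subset_open_cover_Icc hab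
    (c := fun u : ℝ => ((↑) : Icc a b → ℝ) ⁻¹' interior (U u))
    (fun u => isOpen_interior.preimage continuous_subtype_val)
    (fun x _ => mem_iUnion.2 ⟨x, mem_interior_iff_mem_nhds.2 (hU _)⟩)
  have hstep : ∀ n, ∃ K : NNReal, ∀ t, LipschitzOnWith K (p t) (Icc a (s n)) := by
    intro n
    induction n with
    | zero =>
      refine ⟨0, fun t => ?_⟩
      rw [hs0, Icc_self]
      exact LipschitzOnWith.of_dist_le_mul fun x hx y hy => by simp_all
    | succ n ih =>
      obtain ⟨K, hK⟩ := ih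
      obtain ⟨u, hu⟩ := hsub n
      refine ⟨max K (L u), fun t => (hK t).Icc_union ((hLU u t).mono fun x hx => ?_)⟩
      have hxI : x ∈ Icc a b := ⟨(s n).2.1.trans hx.1, hx.2.trans (s (n + 1)).2.2⟩
      exact interior_subset (hu (show (⟨x, hxI⟩ : Icc a b) ∈ Icc (s n) (s (n + 1)) from hx))
  simpa [hm m le_rfl] using hstep m

theorem IsRegularTerm.exists_lipschitzOnWith {T : ℝ} {p : ℝ → ℝ → ℝ} (hp : IsRegularTerm T p)
    {r : ℝ} (hr : 0 ≤ r) : ∃ K : NNReal, ∀ t, LipschitzOnWith K (p t) (Icc (-r) r) :=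
  exists_lipschitzOnWith_Icc_of_locally hp.locallyLipschitz (by linarith)

/-! ### Bounds on the right-hand side -/

/-- The function `p (·, u)` is not assumed integrable: its bound comes from the one-sided bounds at
`u = -R` (below) and `u = R` (above), which the Lipschitz condition carries to all `|u| ≤ r`. -/
theorem StructuralS2.exists_integrable_bound {T R : ℝ} {G A : ℝ → ℝ → Set ℝ} {p : ℝ → ℝ → ℝ}
    {lm lp : ℝ → ℝ} (hS2 : StructuralS2 T G R lm lp) (hA : IsMonotoneTerm T A)
    (hp : IsRegularTerm T p) (hG : ∀ t u, G t u = {y | ∃ a ∈ A t u, y = -a + p t u})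
    {r : ℝ} (hr : R ≤ r) : ∃ M : ℝ → ℝ, IntervalIntegrable M volume 0 T ∧
      ∀ᵐ t, ∀ u, |u| ≤ r → ∀ a ∈ A t u, |-a + p t u| ≤ M t := by
  have hR := hS2.R_pos
  obtain ⟨m, hm, hmb⟩ := hA.locallyBounded r
  obtain ⟨K, hK⟩ := hp.exists_lipschitzOnWith (hR.le.trans hr)
  refine ⟨fun t => m t + m t + |lm t| + |lp t| + K * (2 * r), ?_, ?_⟩
  · have hmi : IntervalIntegrable m volume 0 T :=
      (hm.integrableOn_isCompact isCompact_uIcc).intervalIntegrable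
    exact (((hmi.add hmi).add hS2.integrable_lm.abs).add hS2.integrable_lp.abs).add
      intervalIntegrable_const
  · filter_upwards [hmb, hS2.lower, hS2.upper] with t htm htl htu u hu a ha
    obtain ⟨a₁, ha₁⟩ := hA.nonempty t (-R)
    obtain ⟨a₂, ha₂⟩ := hA.nonempty t R
    have h1 := htl (-R) le_rfl (-a₁ + p t (-R)) (by rw [hG]; exact ⟨a₁, ha₁, rfl⟩)
    have h2 := htu R le_rfl (-a₂ + p t R) (by rw [hG]; exact ⟨a₂, ha₂, rfl⟩)
    have b0 := abs_le.1 (htm u hu a ha)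
    have b1 := abs_le.1 (htm (-R) (by rwa [abs_neg, abs_of_pos hR]) a₁ ha₁)
    have b2 := abs_le.1 (htm R (by rwa [abs_of_pos hR]) a₂ ha₂)
    have hu' := abs_le.1 hu
    have hlip : ∀ x ∈ Icc (-r) r, |p t u - p t x| ≤ K * (2 * r) := fun x hx => by
      refine ((hK t).dist_le_mul u hu' x hx).trans ?_
      gcongr
      rw [Real.dist_eq, abs_le]
      constructor <;> linarith [hx.1, hx.2, hu'.1, hu'.2]
    have c1 := abs_le.1 (hlip (-R) ⟨by linarith, by linarith⟩)
    have c2 := abs_le.1 (hlip R ⟨by linarith, by linarith⟩)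
    have d1 := abs_nonneg (lm t)
    have d2 := abs_nonneg (lp t)
    have d3 := le_abs_self (lm t)
    have d4 := le_abs_self (lp t)
    rw [abs_le]
    constructor <;> linarith

/-- The right-hand side `-A + p` is one-sided Lipschitz where `p` is Lipschitz. -/
theorem SetMonotone.neg_add_sub_le {F : ℝ → Set ℝ} (hF : SetMonotone F) {g : ℝ → ℝ} {K : NNReal}
    {s : Set ℝ} (hg : LipschitzOnWith K g s) {u w a b : ℝ} (hu : u ∈ s) (hw : w ∈ s) (hwu : w < u)
    (ha : a ∈ F u) (hb : b ∈ F w) : (-a + g u) - (-b + g w) ≤ K * (u - w) := by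
  have h1 := hF.le_of_lt hwu hb ha
  have h2 := (le_abs_self _).trans (hg.dist_le_mul u hu w hw)
  rw [Real.dist_eq, abs_of_pos (sub_pos.2 hwu)] at h2
  linarith

/-! ### Existence of solutions of the inclusion -/

/-- If the derivative `y` of `v` at `t` is compatible with the selection `-sInf (F q) + g q` at all
rational levels `q` in an open interval around `v t`, then `y` solves the inclusion
`y ∈ -F (v t) + g (v t)`. -/
theorem SetMaximalMonotone.neg_sub_mem_of_rat {F : ℝ → Set ℝ} (hF : SetMaximalMonotone F)
    (hne : ∀ u, (F u).Nonempty) {g : ℝ → ℝ} (hg : Continuous g) {L c d x y : ℝ}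
    (hx : x ∈ Ioo c d)
    (hup : ∀ q : ℚ, (q : ℝ) ∈ Ioo c d → (q : ℝ) < x → y ≤ -sInf (F q) + g q + L * (x - q))
    (hlow : ∀ q : ℚ, (q : ℝ) ∈ Ioo c d → x < (q : ℝ) → -sInf (F q) + g q - L * (q - x) ≤ y) :
    -(y - g x) ∈ F x := by
  have hcont : Continuous fun q => g q + L * (x - q) := by fun_prop
  have hsel := hF.sInf_mem hne
  refine hF.mem_of_forall fun u' hu' y' hy' => ?_
  rcases lt_or_gt_of_ne hu' with hlt | hlt
  · refine mul_nonneg_of_nonpos_of_nonpos (sub_nonpos.2 ?_) (by linarith)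
    refine le_of_forall_pos_le_add fun ε hε => ?_
    have hev : ∀ᶠ q in 𝓝 x, g q + L * (x - q) < g x + ε :=
      (hcont.tendsto x).eventually (gt_mem_nhds (by simpa using hε))
    obtain ⟨δ, hδ, hδ'⟩ := Metric.eventually_nhds_iff.1 hev
    obtain ⟨q, hq1, hq2⟩ := exists_rat_btwn (max_lt (max_lt hlt hx.1) (sub_lt_self x hδ))
    obtain ⟨hq3, hq4⟩ := max_lt_iff.1 hq1
    obtain ⟨hq5, hq6⟩ := max_lt_iff.1 hq3
    have h1 := hup q ⟨hq6, hq2.trans hx.2⟩ hq2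
    have h2 := hδ' (y := (q : ℝ)) (by rw [Real.dist_eq, abs_of_neg (by linarith)]; linarith)
    have h3 := hF.1.le_of_lt hq5 hy' (hsel q)
    linarith
  · refine mul_nonneg (sub_nonneg.2 ?_) (by linarith)
    refine le_of_forall_pos_le_add fun ε hε => ?_
    have hev : ∀ᶠ q in 𝓝 x, g x - ε < g q + L * (x - q) :=
      (hcont.tendsto x).eventually (lt_mem_nhds (by simpa using hε))
    obtain ⟨δ, hδ, hδ'⟩ := Metric.eventually_nhds_iff.1 hev
    obtain ⟨q, hq2, hq1⟩ := exists_rat_btwn (lt_min (lt_min hlt hx.2) (lt_add_of_pos_right x hδ))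
    obtain ⟨hq3, hq4⟩ := lt_min_iff.1 hq1
    obtain ⟨hq5, hq6⟩ := lt_min_iff.1 hq3
    have h1 := hlow q ⟨hx.1.trans hq2, hq6⟩ hq2
    have h2 := hδ' (y := (q : ℝ)) (by rw [Real.dist_eq, abs_of_pos (by linarith)]; linarith)
    have h3 := hF.1.le_of_lt hq5 (hsel q) hy'
    linarith

theorem abs_le_of_dissipative {v lm lp : ℝ → ℝ} {R T : ℝ}
    (hv : AbsolutelyContinuousOnInterval v 0 T)
    (hlm : IntervalIntegrable lm volume 0 T) (hlp : IntervalIntegrable lp volume 0 T)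
    (hup : ∀ᵐ t, t ∈ Ioo 0 T → R < v t → deriv v t ≤ lp t)
    (hlow : ∀ᵐ t, t ∈ Ioo 0 T → R < -v t → deriv (fun t => -v t) t ≤ lm t)
    {t : ℝ} (ht : t ∈ Icc 0 T) :
    |v t| ≤ max |v 0| R + ((∫ r in (0 : ℝ)..T, |lp r|) + ∫ r in (0 : ℝ)..T, |lm r|) := by
  have h1 := le_max_add_integral_abs_of_mem hv hlp hup le_rfl ht.1 ht.2
  have h2 := le_max_add_integral_abs_of_mem hv.neg hlm hlow le_rfl ht.1 ht.2
  have i1 : 0 ≤ ∫ r in (0 : ℝ)..T, |lp r| :=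
    intervalIntegral.integral_nonneg (ht.1.trans ht.2) fun _ _ => abs_nonneg _
  have i2 : 0 ≤ ∫ r in (0 : ℝ)..T, |lm r| :=
    intervalIntegral.integral_nonneg (ht.1.trans ht.2) fun _ _ => abs_nonneg _
  have m1 : max (v 0) R ≤ max |v 0| R := max_le_max_right _ (le_abs_self _)
  have m2 : max (-v 0) R ≤ max |v 0| R := max_le_max_right _ (neg_le_abs _)
  simp only [Pi.neg_apply] at h2
  rw [abs_le]
  constructor <;> linarith

/-- Existence. The right-hand side is truncated outside a large interval `[-C, C]`, its selection
`-sInf A + p` is fed to the Euler scheme, and the one-sided bounds keep the solution inside. -/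
theorem StructuralS2.exists_isSolutionOn {T R : ℝ} (hT : 0 < T) {G A : ℝ → ℝ → Set ℝ}
    {p : ℝ → ℝ → ℝ} {lm lp : ℝ → ℝ} (hS2 : StructuralS2 T G R lm lp) (hA : IsMonotoneTerm T A)
    (hp : IsRegularTerm T p) (hG : ∀ t u, G t u = {y | ∃ a ∈ A t u, y = -a + p t u}) (x₀ : ℝ) :
    ∃ v : ℝ → ℝ, IsSolutionOn G 0 T v ∧ v 0 = x₀ := by
  have hR := hS2.R_pos
  have i1 : 0 ≤ ∫ r in (0 : ℝ)..T, |lp r| :=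
    intervalIntegral.integral_nonneg hT.le fun _ _ => abs_nonneg _
  have i2 : 0 ≤ ∫ r in (0 : ℝ)..T, |lm r| :=
    intervalIntegral.integral_nonneg hT.le fun _ _ => abs_nonneg _
  set C : ℝ := max |x₀| R + ((∫ r in (0 : ℝ)..T, |lp r|) + ∫ r in (0 : ℝ)..T, |lm r|) + 1 with hC
  have hRC : R < C := by have := le_max_right |x₀| R; linarith
  have hC0 : -C ≤ C := by linarith
  obtain ⟨M, hM, hMb⟩ := hS2.exists_integrable_bound hA hp hG hRC.le
  obtain ⟨K, hK⟩ := hp.exists_lipschitzOnWith (hR.le.trans hRC.le)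
  have hsel : ∀ t u, sInf (A t u) ∈ A t u := fun t u =>
    (hA.maximalMonotone t).sInf_mem (hA.nonempty t) u
  set cl : ℝ → ℝ := fun u => max (-C) (min u C) with hcl
  have hclI : ∀ u, cl u ∈ Icc (-C) C := fun u =>
    ⟨le_max_left _ _, max_le hC0 (min_le_right _ _)⟩
  have hclid : ∀ u ∈ Ioo (-C) C, cl u = u := fun u hu => by
    simp only [hcl, min_eq_left hu.2.le, max_eq_right hu.1.le]
  have hclmono : Monotone cl := fun u w h => max_le_max_left _ (min_le_min_right _ h)
  have hclsub : ∀ u w, w ≤ u → cl u - cl w ≤ u - w := by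
    intro u w h
    simp only [hcl]
    grind
  set f : ℝ → ℝ → ℝ := fun t u =>
    (Ioc 0 T).indicator (fun t => -sInf (A t (cl u)) + p t (cl u)) t with hf
  have hfin : ∀ t ∈ Ioo 0 T, ∀ u, f t u = -sInf (A t (cl u)) + p t (cl u) := fun t ht u =>
    indicator_of_mem (Ioo_subset_Ioc_self ht) _
  have hfm : ∀ u, AEMeasurable (fun t => f t u) volume := fun u =>
    ((((hA.measurable (cl u)).aemeasurable_sInf (fun t => hA.nonempty t _)
      (fun t => (hA.maximalMonotone t).1.bddBelow (hA.nonempty t) _)).neg).add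
      (hp.measurable (cl u))).indicator measurableSet_Ioc
  have hMi : Integrable ((Ioc 0 T).indicator M) volume :=
    ((intervalIntegrable_iff_integrableOn_Ioc_of_le hT.le).1 hM).integrable_indicator
      measurableSet_Ioc
  have hfb : ∀ᵐ t, ∀ u, |f t u| ≤ (Ioc 0 T).indicator M t := by
    filter_upwards [hMb] with t ht u
    simp only [hf, indicator]
    split_ifs
    · exact ht _ (abs_le.2 (hclI u)) _ (hsel t _)
    · simp
  have hos : ∀ t u w, w ≤ u → f t u - f t w ≤ K * (u - w) := by
    intro t u w hwu
    have h0 : (0 : ℝ) ≤ K * (u - w) := mul_nonneg K.coe_nonneg (by linarith)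
    simp only [hf, indicator]
    split_ifs
    · rcases (hclmono hwu).eq_or_lt with heq | hlt
      · rw [heq]; simpa using h0
      · refine ((hA.maximalMonotone t).1.neg_add_sub_le (hK t) (hclI u) (hclI w) hlt
          (hsel t _) (hsel t _)).trans ?_
        exact mul_le_mul_of_nonneg_left (hclsub u w hwu) K.coe_nonneg
    · simpa using h0
  obtain ⟨v, hv0, hvac, hv⟩ := exists_generalized_solution K.coe_nonneg hT hfm hMi hfb hos x₀
  have hmem : ∀ t u, -sInf (A t u) + p t u ∈ G t u := fun t u => by
    rw [hG]; exact ⟨_, hsel t u, rfl⟩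
  have hup : ∀ᵐ t, t ∈ Ioo 0 T → R < v t → deriv v t ≤ lp t := by
    filter_upwards [hv, hS2.upper] with t ht hu htI hRv
    obtain ⟨y, hy, hyq⟩ := ht htI
    rw [hy.deriv]
    refine le_of_forall_pos_le_add fun ε hε => ?_
    have hK1 : (0 : ℝ) < K + 1 := by have := K.coe_nonneg; positivity
    -- The compatibility is known only at levels below `v t`; one close to `v t` costs at most `ε`.
    obtain ⟨q, hq1, hq2⟩ := exists_rat_btwn (max_lt hRv (sub_lt_self (v t) (div_pos hε hK1)))
    obtain ⟨hq3, hq4⟩ := max_lt_iff.1 hq1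
    have h1 := (hyq q).1 hq2
    rw [hfin t htI] at h1
    have h2 := hu (cl q) (by
      simp only [hcl]; exact le_max_of_le_right (le_min hq3.le hRC.le)) _ (hmem t _)
    have h3 : (K : ℝ) * (v t - q) ≤ ε := by
      have h4 : (v t - q) * (K + 1) ≤ ε := by
        rw [← le_div_iff₀ hK1]; linarith
      nlinarith
    linarith
  have hlow : ∀ᵐ t, t ∈ Ioo 0 T → R < -v t → deriv (fun t => -v t) t ≤ lm t := by
    filter_upwards [hv, hS2.lower] with t ht hu htI hRv
    obtain ⟨y, hy, hyq⟩ := ht htI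
    rw [hy.fun_neg.deriv]
    refine le_of_forall_pos_le_add fun ε hε => ?_
    have hK1 : (0 : ℝ) < K + 1 := by have := K.coe_nonneg; positivity
    obtain ⟨q, hq2, hq1⟩ := exists_rat_btwn
      (lt_min (lt_neg.1 hRv) (lt_add_of_pos_right (v t) (div_pos hε hK1)))
    obtain ⟨hq3, hq4⟩ := lt_min_iff.1 hq1
    have h1 := (hyq q).2 hq2
    rw [hfin t htI] at h1
    have h2 := hu (cl q) (by
      simp only [hcl]
      exact max_le (by linarith) ((min_le_left _ _).trans hq3.le)) _ (hmem t _)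
    have h3 : (K : ℝ) * (q - v t) ≤ ε := by
      have h4 : (q - v t) * (K + 1) ≤ ε := by
        rw [← le_div_iff₀ hK1]; linarith
      nlinarith
    linarith
  refine ⟨v, ⟨hvac, ?_⟩, hv0⟩
  filter_upwards [hv] with t ht htI
  obtain ⟨y, hy, hyq⟩ := ht htI
  refine ⟨y, ?_, hy⟩
  have hbd := abs_le_of_dissipative hvac hS2.integrable_lm hS2.integrable_lp hup hlow
    (Ioo_subset_Icc_self htI)
  rw [hv0] at hbd
  have hvI : v t ∈ Ioo (-C) C := abs_lt.1 (by linarith)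
  have := (hA.maximalMonotone t).neg_sub_mem_of_rat (hA.nonempty t) (hp.continuous t) hvI
    (fun q hqI hq => by
      have := (hyq q).1 hq
      rwa [hfin t htI, hclid _ hqI] at this)
    (fun q hqI hq => by
      have := (hyq q).2 hq
      rwa [hfin t htI, hclid _ hqI] at this)
  rw [hG]
  exact ⟨_, this, by ring⟩

/-! ### Comparison of solutions -/

theorem IsSolutionOn.deriv_le {T R : ℝ} {G : ℝ → ℝ → Set ℝ} {lm lp v : ℝ → ℝ}
    (hv : IsSolutionOn G 0 T v) (hS2 : StructuralS2 T G R lm lp) :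
    ∀ᵐ t, t ∈ Ioo 0 T → R < v t → deriv v t ≤ lp t := by
  filter_upwards [hv.2, hS2.upper] with t ht hu htI hR
  obtain ⟨y, hyG, hy⟩ := ht htI
  rw [hy.deriv]
  exact hu _ hR.le y hyG

theorem IsSolutionOn.deriv_neg_le {T R : ℝ} {G : ℝ → ℝ → Set ℝ} {lm lp v : ℝ → ℝ}
    (hv : IsSolutionOn G 0 T v) (hS2 : StructuralS2 T G R lm lp) :
    ∀ᵐ t, t ∈ Ioo 0 T → R < -v t → deriv (fun t => -v t) t ≤ lm t := by
  filter_upwards [hv.2, hS2.lower] with t ht hu htI hR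
  obtain ⟨y, hyG, hy⟩ := ht htI
  rw [hy.fun_neg.deriv]
  linarith [hu _ (by linarith) y hyG]

/-- Solutions starting in a bounded set depend on the initial value in a one-sided Lipschitz way;
for `v 0 ≤ w 0` this is the comparison principle. -/
theorem StructuralS2.exists_solution_sub_le {T R : ℝ} (hT : 0 < T) {G A : ℝ → ℝ → Set ℝ}
    {p : ℝ → ℝ → ℝ} {lm lp : ℝ → ℝ} (hS2 : StructuralS2 T G R lm lp) (hA : IsMonotoneTerm T A)
    (hp : IsRegularTerm T p) (hG : ∀ t u, G t u = {y | ∃ a ∈ A t u, y = -a + p t u}) (r : ℝ) :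
    ∃ c : ℝ, 0 ≤ c ∧ ∀ v w : ℝ → ℝ, IsSolutionOn G 0 T v → IsSolutionOn G 0 T w →
      |v 0| ≤ r → |w 0| ≤ r → ∀ t ∈ Icc 0 T, v t - w t ≤ c * max (v 0 - w 0) 0 := by
  have hR := hS2.R_pos
  have i1 : 0 ≤ ∫ r in (0 : ℝ)..T, |lp r| :=
    intervalIntegral.integral_nonneg hT.le fun _ _ => abs_nonneg _
  have i2 : 0 ≤ ∫ r in (0 : ℝ)..T, |lm r| :=
    intervalIntegral.integral_nonneg hT.le fun _ _ => abs_nonneg _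
  set C : ℝ := max r R + ((∫ r in (0 : ℝ)..T, |lp r|) + ∫ r in (0 : ℝ)..T, |lm r|) with hC
  obtain ⟨K, hK⟩ := hp.exists_lipschitzOnWith (r := C) (by
    have := le_max_right r R; linarith)
  have hbd : ∀ v : ℝ → ℝ, IsSolutionOn G 0 T v → |v 0| ≤ r → ∀ t ∈ Icc 0 T, v t ∈ Icc (-C) C := by
    intro v hv hv0 t ht
    have := abs_le_of_dissipative hv.1 hS2.integrable_lm hS2.integrable_lp (hv.deriv_le hS2)
      (hv.deriv_neg_le hS2) ht
    have h2 : max |v 0| R ≤ max r R := max_le_max_right _ hv0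
    exact abs_le.1 (by linarith)
  refine ⟨Real.exp (K * T), (Real.exp_pos _).le, fun v w hv hw hv0 hw0 t ht => ?_⟩
  have hsub : uIcc 0 t ⊆ uIcc 0 T := by
    rw [uIcc_of_le hT.le, uIcc_of_le ht.1]; exact Icc_subset_Icc_right ht.2
  have := le_exp_mul_of_deriv_le (z := fun t => v t - w t) (m := fun _ => 0) (L := K) ht.1 K.coe_nonneg
    ((hv.1.sub hw.1).mono hsub) intervalIntegrable_const (fun _ => le_rfl) (by
      filter_upwards [hv.2, hw.2] with s hvs hws hsI hpos
      have hsT : s ∈ Ioo 0 T := ⟨hsI.1, hsI.2.trans_le ht.2⟩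
      obtain ⟨y₁, hy₁, hd₁⟩ := hvs hsT
      obtain ⟨y₂, hy₂, hd₂⟩ := hws hsT
      rw [hG] at hy₁ hy₂
      obtain ⟨a, ha, rfl⟩ := hy₁
      obtain ⟨b, hb, rfl⟩ := hy₂
      rw [(hd₁.fun_sub hd₂).deriv, add_zero]
      exact (hA.maximalMonotone s).1.neg_add_sub_le (hK s)
        (hbd v hv hv0 s (Ioo_subset_Icc_self hsT)) (hbd w hw hw0 s (Ioo_subset_Icc_self hsT))
        (by linarith) ha hb)
  simp only [intervalIntegral.integral_zero, add_zero, sub_zero] at this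
  refine this.trans ?_
  have h0 : (0 : ℝ) ≤ max (v 0 - w 0) 0 := le_max_right _ _
  have := ht.2
  gcongr

theorem StructuralS2.solution_le {T R : ℝ} (hT : 0 < T) {G A : ℝ → ℝ → Set ℝ}
    {p : ℝ → ℝ → ℝ} {lm lp : ℝ → ℝ} (hS2 : StructuralS2 T G R lm lp) (hA : IsMonotoneTerm T A)
    (hp : IsRegularTerm T p) (hG : ∀ t u, G t u = {y | ∃ a ∈ A t u, y = -a + p t u})
    {v w : ℝ → ℝ} (hv : IsSolutionOn G 0 T v) (hw : IsSolutionOn G 0 T w) (h : v 0 ≤ w 0)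
    {t : ℝ} (ht : t ∈ Icc 0 T) : v t ≤ w t := by
  obtain ⟨c, -, hc⟩ := hS2.exists_solution_sub_le hT hA hp hG (max |v 0| |w 0|)
  have := hc v w hv hw (le_max_left _ _) (le_max_right _ _) t ht
  rw [max_eq_right (by linarith), mul_zero] at this
  linarith

/-! ### Monotone dissipative dynamics on the line -/

/-- If `Φ` decreases every point above `b` by at least `δ` until it falls below `b`, then the
iterates starting below `c` are uniformly below `b` from some time on. -/
theorem exists_iterate_le_of_forall_le_max {Φ : ℝ → ℝ} {b δ : ℝ} (hδ : 0 < δ)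
    (h : ∀ x, Φ x ≤ max b (x - δ)) (c : ℝ) : ∃ N : ℕ, ∀ x ≤ c, ∀ i ≥ N, Φ^[i] x ≤ b := by
  have key : ∀ x, ∀ i : ℕ, Φ^[i] x ≤ max b (x - i * δ) := by
    intro x i
    induction i with
    | zero => simp
    | succ i ih =>
      rw [Function.iterate_succ_apply']
      refine (h _).trans (max_le (le_max_left _ _) ?_)
      rcases le_max_iff.1 ih with h1 | h1
      · exact le_max_of_le_left (by linarith)
      · exact le_max_of_le_right (by push_cast; linarith)
  obtain ⟨N, hN⟩ := exists_nat_ge ((c - b) / δ)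
  refine ⟨N, fun x hx i hi => (key x i).trans (max_le le_rfl ?_)⟩
  rw [div_le_iff₀ hδ] at hN
  have : (N : ℝ) * δ ≤ i * δ := by gcongr
  linarith

/-- The reflection under `x ↦ -x` of `exists_iterate_le_of_forall_le_max`. -/
theorem exists_le_iterate_of_forall_min_le {Φ : ℝ → ℝ} {a δ : ℝ} (hδ : 0 < δ)
    (h : ∀ x, min a (x + δ) ≤ Φ x) (c : ℝ) : ∃ N : ℕ, ∀ x ≥ c, ∀ i ≥ N, a ≤ Φ^[i] x := by
  have hit : ∀ x, ∀ i : ℕ, (fun x => -Φ (-x))^[i] x = -Φ^[i] (-x) := by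
    intro x i
    induction i with
    | zero => simp
    | succ i ih => rw [Function.iterate_succ_apply', Function.iterate_succ_apply', ih, neg_neg]
  obtain ⟨N, hN⟩ := exists_iterate_le_of_forall_le_max (Φ := fun x => -Φ (-x)) (b := -a) hδ
    (fun x => by
      have := h (-x)
      rcases min_le_iff.1 this with h1 | h1
      · exact le_max_of_le_left (by linarith)
      · exact le_max_of_le_right (by linarith)) (-c)
  refine ⟨N, fun x hx i hi => ?_⟩
  have := hN (-x) (by linarith) i hi
  rw [hit, neg_neg] at this
  linarith

theorem Monotone.image_Icc_of_continuous {Φ : ℝ → ℝ} (hm : Monotone Φ) (hc : Continuous Φ)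
    {a b : ℝ} (hab : a ≤ b) : Φ '' Icc a b = Icc (Φ a) (Φ b) :=
  Subset.antisymm (image_subset_iff.2 fun _ hx => ⟨hm hx.1, hm hx.2⟩)
    (intermediate_value_Icc hab hc.continuousOn)

/-- A continuous increasing map of the line that moves points above `b` down and points below `a`
up by a definite amount has the interval between the limits of `Φ^[i] a` and `Φ^[i] b` as its global
attractor, and each of its orbits, being monotone, converges to a fixed point. -/
theorem exists_attractor_of_monotone {Φ : ℝ → ℝ} {a b δ₁ δ₂ : ℝ} (hm : Monotone Φ)
    (hc : Continuous Φ) (hab : a ≤ b) (hδ₁ : 0 < δ₁) (hδ₂ : 0 < δ₂)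
    (hup : ∀ x, Φ x ≤ max b (x - δ₁)) (hlow : ∀ x, min a (x + δ₂) ≤ Φ x) :
    ∃ α β : ℝ, α ≤ β ∧ (⋂ i : ℕ, Φ^[i] '' Icc a b) = Icc α β ∧ IsGlobalAttractor Φ (Icc α β) ∧
      Φ α = α ∧ Φ β = β ∧ ∀ v₀ : ℝ, ∃ vStar ∈ Icc α β, Φ vStar = vStar ∧
        Tendsto (fun i : ℕ => Φ^[i] v₀) atTop (𝓝 vStar) := by
  have hbb : Φ b ≤ b := (hup b).trans (max_le le_rfl (by linarith))
  have haa : a ≤ Φ a := (le_min le_rfl (by linarith)).trans (hlow a)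
  have hmi : ∀ i, Monotone Φ^[i] := fun i => hm.iterate i
  have hanti : Antitone fun i => Φ^[i] b := hm.antitone_iterate_of_map_le hbb
  have hmono : Monotone fun i => Φ^[i] a := hm.monotone_iterate_of_le_map haa
  have hbdb : BddBelow (range fun i => Φ^[i] b) :=
    ⟨a, by rintro _ ⟨i, rfl⟩; exact (hmono (Nat.zero_le i)).trans (hmi i hab)⟩
  have hbda : BddAbove (range fun i => Φ^[i] a) :=
    ⟨b, by rintro _ ⟨i, rfl⟩; exact (hmi i hab).trans (hanti (Nat.zero_le i))⟩
  set α := ⨆ i, Φ^[i] a with hα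
  set β := ⨅ i, Φ^[i] b with hβ
  have hta : Tendsto (fun i => Φ^[i] a) atTop (𝓝 α) := tendsto_atTop_ciSup hmono hbda
  have htb : Tendsto (fun i => Φ^[i] b) atTop (𝓝 β) := tendsto_atTop_ciInf hanti hbdb
  have hαβ : α ≤ β := le_of_tendsto_of_tendsto' hta htb fun i => hmi i hab
  have hΦα : Φ α = α := isFixedPt_of_tendsto_iterate hta hc.continuousAt
  have hΦβ : Φ β = β := isFixedPt_of_tendsto_iterate htb hc.continuousAt
  have himg : ∀ i, Φ^[i] '' Icc a b = Icc (Φ^[i] a) (Φ^[i] b) := fun i =>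
    (hmi i).image_Icc_of_continuous (hc.iterate i) hab
  -- The orbits of a bounded set enter `[a, b]`, and are afterwards squeezed between those of
  -- `a` and `b`.
  have hsq : ∀ c, ∃ N : ℕ, ∀ x, |x| ≤ c → ∀ i, Φ^[i + N] x ∈ Icc (Φ^[i] a) (Φ^[i] b) := by
    intro c
    obtain ⟨N₁, hN₁⟩ := exists_iterate_le_of_forall_le_max hδ₁ hup c
    obtain ⟨N₂, hN₂⟩ := exists_le_iterate_of_forall_min_le hδ₂ hlow (-c)
    refine ⟨max N₁ N₂, fun x hx i => ?_⟩
    rw [Function.iterate_add_apply]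
    exact ⟨hmi i (hN₂ x (abs_le.1 hx).1 _ (le_max_right _ _)),
      hmi i (hN₁ x (abs_le.1 hx).2 _ (le_max_left _ _))⟩
  refine ⟨α, β, hαβ, ?_, ⟨nonempty_Icc.2 hαβ, isCompact_Icc, ?_, ?_⟩, hΦα, hΦβ, ?_⟩
  · ext x
    simp only [himg, mem_iInter, mem_Icc]
    exact ⟨fun h => ⟨ciSup_le fun i => (h i).1, le_ciInf fun i => (h i).2⟩,
      fun h i => ⟨(le_ciSup hbda i).trans h.1, h.2.trans (ciInf_le hbdb i)⟩⟩
  · rw [hm.image_Icc_of_continuous hc hαβ, hΦα, hΦβ]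
  · intro B hB ε hε
    obtain ⟨c, hcB⟩ := hB.exists_norm_le
    obtain ⟨N, hN⟩ := hsq c
    have h1 := (hta.comp (tendsto_sub_atTop_nat N)).eventually
      (lt_mem_nhds (show α - ε < α by linarith))
    have h2 := (htb.comp (tendsto_sub_atTop_nat N)).eventually
      (gt_mem_nhds (show β < β + ε by linarith))
    filter_upwards [h1, h2, eventually_ge_atTop N] with i hi1 hi2 hi
    rintro _ ⟨x, hx, rfl⟩
    have h3 := hN x (hcB x hx) (i - N)
    rw [Nat.sub_add_cancel hi] at h3
    obtain ⟨h4, h5⟩ := h3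
    rw [Metric.mem_thickening_iff]
    -- The nearest point of `[α, β]`.
    refine ⟨max α (min (Φ^[i] x) β), ⟨le_max_left _ _, max_le hαβ (min_le_right _ _)⟩, ?_⟩
    rw [Real.dist_eq, abs_lt]
    simp only [Function.comp_apply] at hi1 hi2
    grind
  · intro v₀
    obtain ⟨N, hN⟩ := hsq |v₀|
    have hin : ∀ i, Φ^[i + N] v₀ ∈ Icc (Φ^[i] a) (Φ^[i] b) := hN v₀ le_rfl
    have hconv : ∃ x, Tendsto (fun i => Φ^[i + N] v₀) atTop (𝓝 x) := by
      rcases le_total v₀ (Φ v₀) with hle | hle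
      · refine ⟨_, tendsto_atTop_ciSup
          (fun i j hij => hm.monotone_iterate_of_le_map hle (Nat.add_le_add_right hij N)) ⟨b, ?_⟩⟩
        rintro _ ⟨i, rfl⟩
        exact (hin i).2.trans (hanti (Nat.zero_le i))
      · refine ⟨_, tendsto_atTop_ciInf
          (fun i j hij => hm.antitone_iterate_of_map_le hle (Nat.add_le_add_right hij N)) ⟨a, ?_⟩⟩
        rintro _ ⟨i, rfl⟩
        exact (hmono (Nat.zero_le i)).trans (hin i).1
    obtain ⟨x, hx⟩ := hconv
    have hx' : Tendsto (fun i => Φ^[i] v₀) atTop (𝓝 x) := (tendsto_add_atTop_iff_nat N).1 hx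
    exact ⟨x, ⟨le_of_tendsto_of_tendsto' hta hx fun i => (hin i).1,
      le_of_tendsto_of_tendsto' hx htb fun i => (hin i).2⟩,
      isFixedPt_of_tendsto_iterate hx' hc.continuousAt, hx'⟩

/-! ### The Poincaré map -/

theorem mainTheorem6 (T : ℝ) (hT : 0 < T) (G : ℝ → ℝ → Set ℝ) (R : ℝ) (lm lp : ℝ → ℝ)
    (hS1 : StructuralS1 T G) (hS2 : StructuralS2 T G R lm lp) :
    -- the Poincaré map is well defined: solutions on `[0,T]` exist and are unique
    (∀ x₀ : ℝ, ∃ v : ℝ → ℝ, IsSolutionOn G 0 T v ∧ v 0 = x₀ ∧ poincareMap G T x₀ = v T ∧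
      ∀ w : ℝ → ℝ, IsSolutionOn G 0 T w → w 0 = x₀ → EqOn w v (Icc 0 T)) ∧
    ∃ α β : ℝ, α ≤ β ∧
      (⋂ i : ℕ, (poincareMap G T)^[i] '' Icc (vMinus T R lm) (vPlus T R lp)) = Icc α β ∧
      IsGlobalAttractor (poincareMap G T) (Icc α β) ∧
      poincareMap G T α = α ∧
      poincareMap G T β = β ∧
      ∀ v₀ : ℝ, ∃ vStar ∈ Icc α β, poincareMap G T vStar = vStar ∧
        Tendsto (fun i : ℕ => (poincareMap G T)^[i] v₀) atTop (𝓝 vStar) := by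
  obtain ⟨A, p, hA, hp, hG⟩ := hS1
  have hTI : T ∈ Icc 0 T := right_mem_Icc.2 hT.le
  have huniq : ∀ v w : ℝ → ℝ, IsSolutionOn G 0 T v → IsSolutionOn G 0 T w → v 0 = w 0 →
      EqOn v w (Icc 0 T) := fun v w hv hw h t ht =>
    le_antisymm (hS2.solution_le hT hA hp hG hv hw h.le ht)
      (hS2.solution_le hT hA hp hG hw hv h.ge ht)
  have hΦ : ∀ x₀, ∃ v : ℝ → ℝ, IsSolutionOn G 0 T v ∧ v 0 = x₀ ∧ poincareMap G T x₀ = v T := by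
    intro x₀
    obtain ⟨v, hv, hv0⟩ := hS2.exists_isSolutionOn hT hA hp hG x₀
    obtain ⟨w, hw, hw0, hwT⟩ := Classical.epsilon_spec
      (p := fun y => ∃ v : ℝ → ℝ, IsSolutionOn G 0 T v ∧ v 0 = x₀ ∧ v T = y) ⟨v T, v, hv, hv0, rfl⟩
    exact ⟨w, hw, hw0, hwT.symm⟩
  refine ⟨fun x₀ => ?_, ?_⟩
  · obtain ⟨v, hv, hv0, hvT⟩ := hΦ x₀
    exact ⟨v, hv, hv0, hvT, fun w hw hw0 => huniq w v hw hv (hw0.trans hv0.symm)⟩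
  have hm : Monotone (poincareMap G T) := by
    intro x y hxy
    obtain ⟨v, hv, hv0, hvT⟩ := hΦ x
    obtain ⟨w, hw, hw0, hwT⟩ := hΦ y
    rw [hvT, hwT]
    exact hS2.solution_le hT hA hp hG hv hw (by rwa [hv0, hw0]) hTI
  have hc : Continuous (poincareMap G T) := by
    rw [continuous_iff_continuousAt]
    intro x
    obtain ⟨c, hc0, hc⟩ := hS2.exists_solution_sub_le hT hA hp hG (|x| + 1)
    refine continuousAt_of_locally_lipschitz one_pos c fun y hy => ?_
    obtain ⟨v, hv, hv0, hvT⟩ := hΦ x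
    obtain ⟨w, hw, hw0, hwT⟩ := hΦ y
    rw [Real.dist_eq] at hy
    have hyr : |y| ≤ |x| + 1 := by
      have := abs_sub_abs_le_abs_sub y x
      linarith
    have hxr : |x| ≤ |x| + 1 := by linarith
    have h1 := hc v w hv hw (by rwa [hv0]) (by rwa [hw0]) T hTI
    have h2 := hc w v hw hv (by rwa [hw0]) (by rwa [hv0]) T hTI
    rw [hv0, hw0] at h1 h2
    have h3 : max (x - y) 0 ≤ |y - x| := max_le (by rw [abs_sub_comm]; exact le_abs_self _)
      (abs_nonneg _)
    have h4 : max (y - x) 0 ≤ |y - x| := max_le (le_abs_self _) (abs_nonneg _)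
    rw [Real.dist_eq, Real.dist_eq, hvT, hwT, abs_le]
    have h5 := mul_le_mul_of_nonneg_left h3 hc0
    have h6 := mul_le_mul_of_nonneg_left h4 hc0
    constructor <;> linarith
  have i1 : 0 ≤ ∫ r in (0 : ℝ)..T, |lp r| :=
    intervalIntegral.integral_nonneg hT.le fun _ _ => abs_nonneg _
  have i2 : 0 ≤ ∫ r in (0 : ℝ)..T, |lm r| :=
    intervalIntegral.integral_nonneg hT.le fun _ _ => abs_nonneg _
  have hR := hS2.R_pos
  refine exists_attractor_of_monotone hm hc (by unfold vMinus vPlus; linarith)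
    (neg_pos.2 hS2.integral_lp_neg) (neg_pos.2 hS2.integral_lm_neg) (fun x => ?_) (fun x => ?_)
  · obtain ⟨v, hv, rfl, hvT⟩ := hΦ x
    rw [hvT, sub_neg_eq_add]
    exact le_max_integral_of_dissipative hT.le hv.1 hS2.integrable_lp (hv.deriv_le hS2)
  · obtain ⟨v, hv, rfl, hvT⟩ := hΦ x
    rw [hvT]
    have := le_max_integral_of_dissipative hT.le hv.1.neg hS2.integrable_lm (hv.deriv_neg_le hS2)
    simp only [Pi.neg_apply] at this
    unfold vMinus
    rcases le_max_iff.1 this with h | h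
    · exact min_le_of_left_le (by linarith)
    · exact min_le_of_right_le (by linarith)
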